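/- **Half-integer four-parameter family for $\pi^2$.** A continued fraction (CF) $(a_n,b_n)_{n\ge0}$ is a pair of sequences of rational numbers, with $b_n\ne0$ for all $n$, standing for $a_0+b_0/(a_1+b_1/(a_2+b_2/(a_3+\cdots)))$; its convergents are $p_n/q_n=a_0+b_0/(a_1+\cdots+b_{n-1}/a_n)$, and it converges to $z$ if $q_n\neq 0$ for $n$ large and $p_n/q_n\to z$. A pair $(A,B)$ of polynomials with rational coefficients *represents* $z$ if there is a CF $(a_n,b_n)$ converging to $z$ such that $a_n=A(n)$ and $b_n=B(n)$ for all sufficiently large $n$. Let $u,v,k$ be nonnegative integers and $w\in\mathbb{Z}$, with $u+v+w+2k\ge0$. Put $$A(n)=4n^2+(6u+2v+2w-5)n+2k^2+(2u+2v+2w+1)k+2u^2+(2v+2w-3)u+v(2w-1)+2,$$ $$B(n)=-2n(n+u)(n+u+v)(2n+2u+2w-1).$$ Then: 1. $(A,B)$ represents $\pi^2$. 2. For every CF $(a_n,b_n)$ converging to $\pi^2$ with $a_n=A(n)$ and $b_n=B(n)$ for all sufficiently large $n$, the speed of convergence is $C/n^{u+v+w+2k+1/2}$; that is, there is a constant $C\ne0$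 such that $$\pi^2-\frac{p_n}{q_n}\sim\frac{C}{n^{u+v+w+2k+1/2}}\qquad(n\to\infty).$$ 3. The family arises by shifting one parameter of the following family to a half-integer: if $$A_1(n)=2n^2+(3u+v+w'-2)n+k^2+u^2+uk+vk+w'k+uv+uw'+vw'+k-u+1,$$ $$B_1(n)=-n(n+u)(n+u+v)(n+u+w'),$$ then for $w'=w-\tfrac12$ one has $A=2A_1$ and $B=4B_1$. -/

import Mathlib

open Filter Topology Polynomial

/-- The continued fraction `a 0 + b 0 / (a 1 + b 1 / (a 2 + b 2 / (a 3 + ⋯)))`. -/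
def contFrac (a b : ℕ → ℚ) : GenContFract ℚ where
  h := a 0
  s := Stream'.Seq.ofStream (fun n => ⟨b n, a (n + 1)⟩)

/-- The convergents `p n / q n` of the continued fraction `(a, b)` tend to `z`; they have to be
genuine fractions (`q n ≠ 0`) from some index on. -/
def CFConvergesTo (a b : ℕ → ℚ) (z : ℝ) : Prop :=
  (∀ᶠ n in atTop, (contFrac a b).dens n ≠ 0) ∧
    Tendsto (fun n => (((contFrac a b).convs n : ℚ) : ℝ)) atTop (𝓝 z)

/-- `(a, b)` is a continued fraction (all `b n` nonzero) which converges to `z` and whose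
coefficients are `A(n)` and `B(n)` for all sufficiently large `n`. -/
structure IsCFOfType (A B : ℚ[X]) (z : ℝ) (a b : ℕ → ℚ) : Prop where
  b_ne_zero : ∀ n, b n ≠ 0
  a_eq : ∀ᶠ n in atTop, a n = A.eval (n : ℚ)
  b_eq : ∀ᶠ n in atTop, b n = B.eval (n : ℚ)
  converges : CFConvergesTo a b z

/-- The pair of polynomials `(A, B)` represents `z`. -/
def Represents (A B : ℚ[X]) (z : ℝ) : Prop :=
  ∃ a b : ℕ → ℚ, IsCFOfType A B z a b

/-- The continued fraction `(a, b)` for `z` has speed of convergence `C / n ^ P` for some nonzero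
constant `C`, i.e. `z - p n / q n ∼ C / n ^ P`. -/
def HasCFSpeed (a b : ℕ → ℚ) (z P : ℝ) : Prop :=
  ∃ C : ℝ, C ≠ 0 ∧
    Tendsto (fun n : ℕ => (z - (((contFrac a b).convs n : ℚ) : ℝ)) * (n : ℝ) ^ P) atTop (𝓝 C)

/-- The polynomial `A` of the basic four-parameter family, with parameters in `ℚ`. -/
noncomputable def firstFamilyA (u v w k : ℚ) : ℚ[X] :=
  2 * X ^ 2 + C (3 * u + v + w - 2) * X
    + C (k ^ 2 + u ^ 2 + u * k + v * k + w * k + u * v + u * w + v * w + k - u + 1)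

/-- The polynomial `B` of the basic four-parameter family, with parameters in `ℚ`. -/
noncomputable def firstFamilyB (u v w : ℚ) : ℚ[X] :=
  -X * (X + C u) * (X + C (u + v)) * (X + C (u + w))

/-- The polynomial `A` of the half-integer four-parameter family. -/
noncomputable def halfFamilyA (u v : ℕ) (w : ℤ) (k : ℕ) : ℚ[X] :=
  4 * X ^ 2 + C (6 * (u : ℚ) + 2 * v + 2 * w - 5) * X
    + C (2 * (k : ℚ) ^ 2 + (2 * u + 2 * v + 2 * w + 1) * k + 2 * u ^ 2 + (2 * v + 2 * w - 3) * u
        + v * (2 * w - 1) + 2)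

/-- The polynomial `B` of the half-integer four-parameter family. -/
noncomputable def halfFamilyB (u v : ℕ) (w : ℤ) : ℚ[X] :=
  -2 * X * (X + C (u : ℚ)) * (X + C ((u : ℚ) + v)) * (2 * X + C (2 * (u : ℚ) + 2 * w - 1))

/-! Put d = u+v+1 and e = u+w+1/2. Dividing numerators and denominators by N(n) = ∏_{i<n}
2(d+i)(e+i) turns the three-term recurrence into the second-order difference equation `HahnEq` of
degree k (`halfFamily_recurrence_iff`). So everything reduces to two solutions of that equation. For
k = 0 these are the constant 1 and the partial sums of `hypTerm u d e`. Taking differences of a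
solution lowers k by one and raises d and e by one; undoing this k times (`hahnLift`) gives y ∼ c
n^k and x with x/y → S, where S is the sum of the series with parameters d+k, e+k
(`exists_hahn_solutions`). S lies in ℚ + ℚˣπ²: contiguity relations, which telescope, connect the
series to the one with u = 0, d = 1, e = 1/2, whose sum π²/2 comes from the integrals of x cos^n x
(`hasPiSqSum_hypTerm`). A rational change of basis then makes the limit π². For the speed, the
Casoratian of two solutions is a multiple of `hypTerm u d e` ≈ n^(u-d-e). Dividing by y(n) y(n+1)
and summing, every solution is y(L + κρ) with ρ ∼ C/n^P and P = d+e-u-1+2k = u+v+w+2k+1/2. The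
quotient of two independent solutions therefore approaches its limit at exactly this rate
(`quotient_speed`). -/

/-! ### The base series with sum π²/2. -/

/-- The integrals `∫ x cos ^ n x` over `[0, π / 2]`. -/
noncomputable def xCosIntegral (n : ℕ) : ℝ := ∫ x in (0 : ℝ)..(Real.pi / 2), x * Real.cos x ^ n

theorem xCosIntegral_zero : xCosIntegral 0 = Real.pi ^ 2 / 8 := by
  simp only [xCosIntegral, pow_zero, mul_one, integral_id]
  ring

/-- Integration by parts, packaged as one explicit primitive; its only nonzero boundary value is
1/(n+2)² at x = 0. -/
theorem xCosIntegral_add_two (n : ℕ) :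
    xCosIntegral (n + 2) = (n + 1) / (n + 2) * xCosIntegral n - 1 / ((n : ℝ) + 2) ^ 2 := by
  have hn : ((n : ℝ) + 2) ≠ 0 := by positivity
  have hder : ∀ x ∈ Set.uIcc (0 : ℝ) (Real.pi / 2), HasDerivAt
      (fun x => x * (Real.cos x ^ (n + 1) * Real.sin x) / (n + 2)
        + Real.cos x ^ (n + 2) / ((n : ℝ) + 2) ^ 2)
      (x * Real.cos x ^ (n + 2) - (n + 1) / (n + 2) * (x * Real.cos x ^ n)) x := by
    intro x _
    have hc := Real.hasDerivAt_cos x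
    have hs := Real.hasDerivAt_sin x
    have := (((hasDerivAt_id x).mul ((hc.pow (n + 1)).mul hs)).div_const ((n : ℝ) + 2)).add
      ((hc.pow (n + 2)).div_const (((n : ℝ) + 2) ^ 2))
    refine this.congr_deriv ?_
    have hs2 : Real.sin x ^ 2 = 1 - Real.cos x ^ 2 := by
      rw [← Real.sin_sq_add_cos_sq x]; ring
    simp only [id, Pi.mul_apply, Pi.pow_apply, Nat.add_sub_cancel,
      show n + 2 - 1 = n + 1 from rfl]
    push_cast
    field_simp
    ring_nf
    rw [hs2]
    ring
  have hi : ∀ m : ℕ, IntervalIntegrable (fun x => x * Real.cos x ^ m) MeasureTheory.volume 0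
      (Real.pi / 2) := fun m => (by fun_prop : Continuous _).intervalIntegrable _ _
  have h := intervalIntegral.integral_eq_sub_of_hasDerivAt hder
    ((hi _).sub ((hi _).const_mul _))
  rw [intervalIntegral.integral_sub (hi _) ((hi _).const_mul _),
    intervalIntegral.integral_const_mul] at h
  simp at h
  unfold xCosIntegral
  rw [sub_eq_iff_eq_add] at h
  rw [h]
  field_simp
  ring

theorem xCosIntegral_nonneg (n : ℕ) : 0 ≤ xCosIntegral n := by
  refine intervalIntegral.integral_nonneg (by positivity) fun x hx => ?_
  have := Real.cos_nonneg_of_mem_Icc ⟨by linarith [hx.1, Real.pi_pos], hx.2⟩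
  exact mul_nonneg hx.1 (by positivity)

/-- Jordan's inequality x ≤ (π/2) sin x bounds the integrand by one with an elementary primitive. -/
theorem xCosIntegral_le (n : ℕ) : xCosIntegral n ≤ Real.pi / 2 / (n + 1) := by
  have hn : ((n : ℝ) + 1) ≠ 0 := by positivity
  have hsin : ∫ x in (0 : ℝ)..(Real.pi / 2), Real.pi / 2 * (Real.cos x ^ n * Real.sin x)
      = Real.pi / 2 / (n + 1) := by
    have hder : ∀ x ∈ Set.uIcc (0 : ℝ) (Real.pi / 2), HasDerivAt
        (fun x => - (Real.pi / 2 * Real.cos x ^ (n + 1) / (n + 1)))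
        (Real.pi / 2 * (Real.cos x ^ n * Real.sin x)) x := by
      intro x _
      have := ((((Real.hasDerivAt_cos x).pow (n + 1)).const_mul (Real.pi / 2)).div_const
        ((n : ℝ) + 1)).neg
      refine this.congr_deriv ?_
      simp only [Nat.add_sub_cancel]
      push_cast
      field_simp
    rw [intervalIntegral.integral_eq_sub_of_hasDerivAt hder
      ((by fun_prop : Continuous _).intervalIntegrable _ _)]
    simp
  rw [← hsin]
  refine intervalIntegral.integral_mono_on (by positivity)
    ((by fun_prop : Continuous _).intervalIntegrable _ _)
    ((by fun_prop : Continuous _).intervalIntegrable _ _) fun x hx => ?_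
  have hc := Real.cos_nonneg_of_mem_Icc ⟨by linarith [hx.1, Real.pi_pos], hx.2⟩
  have hs := Real.mul_le_sin hx.1 hx.2
  have hx' : x ≤ Real.pi / 2 * Real.sin x := by
    have := mul_le_mul_of_nonneg_left hs (by positivity : 0 ≤ Real.pi / 2)
    have hpi := Real.pi_ne_zero
    have e : Real.pi / 2 * (2 / Real.pi * x) = x := by field_simp
    linarith
  calc x * Real.cos x ^ n ≤ Real.pi / 2 * Real.sin x * Real.cos x ^ n :=
        mul_le_mul_of_nonneg_right hx' (by positivity)
    _ = _ := by ring

/-- The Wallis-type products `∏ (2 i + 2) / (2 i + 1)`. -/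
noncomputable def wallisProd (n : ℕ) : ℝ := ∏ i ∈ Finset.range n, ((2 * i + 2) / (2 * i + 1) : ℝ)

theorem wallisProd_succ (n : ℕ) :
    wallisProd (n + 1) = wallisProd n * ((2 * n + 2) / (2 * n + 1)) := Finset.prod_range_succ _ _

theorem wallisProd_pos (n : ℕ) : 0 < wallisProd n := Finset.prod_pos fun _ _ => by positivity

theorem wallisProd_sq_le (n : ℕ) : wallisProd (n + 1) ^ 2 ≤ 4 * (n + 1) := by
  induction n with
  | zero => norm_num [wallisProd]
  | succ n ih =>
    rw [wallisProd_succ, mul_pow]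
    refine (mul_le_mul_of_nonneg_right ih (by positivity)).trans ?_
    push_cast
    rw [div_pow, mul_div_assoc', div_le_iff₀ (by positivity)]
    nlinarith [(Nat.cast_nonneg n : (0 : ℝ) ≤ n)]

/-- The integral is O(1/n), while the Wallis product is only O(√n). -/
theorem tendsto_xCosIntegral_mul_wallisProd :
    Tendsto (fun n => xCosIntegral (2 * n) * wallisProd n) atTop (𝓝 0) := by
  rw [← tendsto_add_atTop_iff_nat 1]
  have hsq : Tendsto (fun n : ℕ => Real.pi / Real.sqrt (n + 1 : ℝ)) atTop (𝓝 0) := by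
    refine Tendsto.div_atTop tendsto_const_nhds ?_
    exact Real.tendsto_sqrt_atTop.comp (tendsto_natCast_atTop_atTop.atTop_add tendsto_const_nhds)
  refine squeeze_zero (fun n => mul_nonneg (xCosIntegral_nonneg _) (wallisProd_pos _).le)
    (fun n => ?_) hsq
  have h1 := xCosIntegral_le (2 * (n + 1))
  have h2 : wallisProd (n + 1) ≤ 2 * Real.sqrt (n + 1) := by
    refine abs_le_of_sq_le_sq' ?_ (by positivity) |>.2
    rw [mul_pow, Real.sq_sqrt (by positivity)]
    linarith [wallisProd_sq_le n]
  refine (mul_le_mul h1 h2 (wallisProd_pos _).le (by positivity)).trans ?_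
  have hs : 0 < Real.sqrt ((n : ℝ) + 1) := by positivity
  have hs2 : Real.sqrt ((n : ℝ) + 1) ^ 2 = n + 1 := Real.sq_sqrt (by positivity)
  push_cast
  rw [div_div, div_mul_eq_mul_div, div_le_div_iff₀ (by positivity) hs]
  have : Real.pi * (2 * √((n : ℝ) + 1)) * √((n : ℝ) + 1) = Real.pi * (2 * (n + 1)) := by
    linear_combination (2 * Real.pi) * hs2
  rw [this]
  exact mul_le_mul_of_nonneg_left (by linarith) Real.pi_pos.le

/-- Multiplying the recurrence of the integrals by the Wallis product makes it telescope; the sum is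
4 times the value π²/8 at index 0. -/
theorem tendsto_sum_wallisProd :
    Tendsto (fun n => ∑ m ∈ Finset.range n, wallisProd (m + 1) / ((m : ℝ) + 1) ^ 2) atTop
      (𝓝 (Real.pi ^ 2 / 2)) := by
  have h : ∀ m : ℕ, wallisProd (m + 1) / ((m : ℝ) + 1) ^ 2
      = -4 * (xCosIntegral (2 * (m + 1)) * wallisProd (m + 1))
        - -4 * (xCosIntegral (2 * m) * wallisProd m) := by
    intro m
    rw [show 2 * (m + 1) = 2 * m + 2 by ring, xCosIntegral_add_two, wallisProd_succ]
    push_cast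
    field_simp
    ring
  simp_rw [h]
  simp_rw [Finset.sum_range_sub (fun m => -4 * (xCosIntegral (2 * m) * wallisProd m))]
  have := (tendsto_xCosIntegral_mul_wallisProd.const_mul (-4)).sub_const
    (-4 * (xCosIntegral (2 * 0) * wallisProd 0))
  convert this using 2
  simp [xCosIntegral_zero, wallisProd]
  ring

/-! ### Hypergeometric terms and their contiguity relations. -/

/-- The term `m! (u + 1)_m / ((d)_{m + 1} (e)_{m + 1})` of a hypergeometric series. -/
def hypTerm {K : Type*} [Field K] (u : ℕ) (d e : K) (m : ℕ) : K :=
  (∏ i ∈ Finset.range m, ((i : K) + 1)) * (∏ i ∈ Finset.range m, ((u : K) + 1 + i)) /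
    ((∏ i ∈ Finset.range (m + 1), (d + i)) * ∏ i ∈ Finset.range (m + 1), (e + i))

section
variable {K : Type*} [Field K] {u : ℕ} {d e : K}

theorem hypTerm_comm (u : ℕ) (d e : K) (m : ℕ) : hypTerm u d e m = hypTerm u e d m := by
  simp only [hypTerm, mul_comm (∏ i ∈ Finset.range (m + 1), (d + i))]

theorem hypTerm_succ (u : ℕ) (d e : K) (m : ℕ) :
    hypTerm u d e (m + 1)
      = hypTerm u d e m * (((m : K) + 1) * (u + 1 + m) / ((d + (m + 1)) * (e + (m + 1)))) := by
  simp only [hypTerm, Finset.prod_range_succ _ m, Finset.prod_range_succ _ (m + 1)]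
  push_cast
  rw [div_mul_div_comm]
  congr 1 <;> ring

theorem hypTerm_ne_zero [CharZero K] (hd : ∀ i : ℕ, d + i ≠ 0) (he : ∀ i : ℕ, e + i ≠ 0) (m : ℕ) :
    hypTerm u d e m ≠ 0 := by
  refine div_ne_zero (mul_ne_zero ?_ ?_) (mul_ne_zero ?_ ?_) <;>
    refine Finset.prod_ne_zero_iff.2 fun i _ => ?_
  · exact Nat.cast_add_one_ne_zero i
  · exact_mod_cast (by omega : u + 1 + i ≠ 0)
  · exact hd i
  · exact he i

theorem hypTerm_add_one_right (he : ∀ i : ℕ, e + i ≠ 0) (m : ℕ) :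
    hypTerm u d (e + 1) m = hypTerm u d e m * (e / (e + 1 + m)) := by
  have key : ∀ m : ℕ, (∏ i ∈ Finset.range m, (e + 1 + i)) * e = ∏ i ∈ Finset.range (m + 1), (e + i) := by
    intro m
    rw [Finset.prod_range_succ']
    push_cast
    simp [add_assoc, add_comm (1 : K)]
  have h2 : e + 1 + (m : K) ≠ 0 := by
    have := he (m + 1); push_cast at this; rwa [add_assoc, add_comm (1 : K)]
  have h0 : e ≠ 0 := by simpa using he 0
  unfold hypTerm
  rw [← key m, Finset.prod_range_succ (fun i : ℕ => e + 1 + (i : K)), div_mul_div_comm]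
  rw [← mul_div_mul_right _ _ h0]
  congr 1
  ring

/-- With d = u+1 the factor (u+1)_m / (d)_{m+1} collapses to 1/(u+1+m), so raising u and d together
changes only this one factor. -/
theorem hypTerm_add_one_both (u m : ℕ) [CharZero K] :
    hypTerm (u + 1) ((u : K) + 2) e m
      = hypTerm u ((u : K) + 1) e m * (((u : K) + 1 + m) / (u + 2 + m)) := by
  have h : ∀ v : ℕ, (∏ i ∈ Finset.range m, ((v : K) + 1 + i)) ≠ 0 := fun v =>
    Finset.prod_ne_zero_iff.2 fun i _ => by exact_mod_cast (by omega : v + 1 + i ≠ 0)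
  have h1 := h u
  have h2 := h (u + 1)
  have h3 : (u : K) + 1 + m ≠ 0 := by exact_mod_cast (by omega : u + 1 + m ≠ 0)
  have h4 : (u : K) + 2 + m ≠ 0 := by exact_mod_cast (by omega : u + 2 + m ≠ 0)
  unfold hypTerm
  push_cast at h2 ⊢
  rw [show (u : K) + 2 = u + 1 + 1 by ring] at *
  rw [Finset.prod_range_succ (fun i : ℕ => (u : K) + 1 + (i : K)) m,
    Finset.prod_range_succ (fun i : ℕ => (u : K) + 1 + 1 + (i : K)) m]
  by_cases hz : (∏ i ∈ Finset.range (m + 1), (e + i)) = 0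
  · simp [hz]
  · field_simp

end

/-- Raising one lower parameter: the contiguity relation is a telescoping one. -/
theorem hypTerm_contiguous (u : ℕ) {d e : ℚ} (hd : ∀ i : ℕ, d + i ≠ 0) (he : ∀ i : ℕ, e + i ≠ 0)
    (m : ℕ) :
    (1 + u - d - e) * hypTerm u d e m + (e - u) * hypTerm u d (e + 1) m
      = hypTerm u d e (m + 1) * ((m + 1 : ℕ) + d) - hypTerm u d e m * (m + d) := by
  rw [hypTerm_add_one_right he, hypTerm_succ]
  have h1 := hd (m + 1)
  have h2 := he (m + 1)
  have h3 : e + 1 + m ≠ 0 := by push_cast at h2; rwa [add_assoc, add_comm (1 : ℚ)]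
  push_cast at *
  field_simp
  ring

/-- Raising the upper parameter. -/
theorem hypTerm_contiguous_upper (u : ℕ) {e : ℚ} (he : ∀ i : ℕ, e + i ≠ 0) (m : ℕ) :
    (u + 1 - e) * hypTerm u ((u : ℚ) + 1) e m + (-(u + 1)) * hypTerm (u + 1) ((u : ℚ) + 2) e m
      = hypTerm u ((u : ℚ) + 1) e (m + 1) * ((m + 1 : ℕ) + e) - hypTerm u ((u : ℚ) + 1) e m * (m + e) := by
  rw [hypTerm_add_one_both, hypTerm_succ]
  have h2 := he (m + 1)
  have h3 : (u : ℚ) + 1 + (m + 1) ≠ 0 := by positivity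
  have h4 : (u : ℚ) + 2 + m ≠ 0 := by positivity
  push_cast at *
  field_simp
  ring

/-- Euler's limit for Γ, applied at d, e and u+1; the extra factor n/(n+u+1) removes the surplus
last factor of the product for u+1. -/
theorem tendsto_hypTerm_mul_rpow (u : ℕ) {d e : ℝ} (hd : ∀ i : ℕ, d + i ≠ 0)
    (he : ∀ i : ℕ, e + i ≠ 0) :
    ∃ L : ℝ, L ≠ 0 ∧ Tendsto (fun n : ℕ => hypTerm u d e n * (n : ℝ) ^ (d + e - u)) atTop (𝓝 L) := by
  have hG : ∀ {a : ℝ}, (∀ i : ℕ, a + i ≠ 0) → Real.Gamma a ≠ 0 := fun h =>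
    Real.Gamma_ne_zero fun m hm => h m (by rw [hm]; ring)
  have hu : ∀ i : ℕ, (u : ℝ) + 1 + i ≠ 0 := fun i => by positivity
  refine ⟨1 * (Real.Gamma d * Real.Gamma e / Real.Gamma (u + 1)), ?_, ?_⟩
  · rw [one_mul]
    exact div_ne_zero (mul_ne_zero (hG hd) (hG he)) (hG hu)
  have hlim : Tendsto (fun n : ℕ => (n : ℝ) / (n + (u + 1))) atTop (𝓝 1) :=
    tendsto_natCast_div_add_atTop _
  refine (hlim.mul (((Real.GammaSeq_tendsto_Gamma d).mul (Real.GammaSeq_tendsto_Gamma e)).div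
    (Real.GammaSeq_tendsto_Gamma (u + 1)) (hG hu))).congr' ?_
  filter_upwards [eventually_gt_atTop 0] with n hn
  have hn' : (0 : ℝ) < n := by exact_mod_cast hn
  have h1 : (∏ i ∈ Finset.range (n + 1), (d + i)) ≠ 0 := Finset.prod_ne_zero_iff.2 fun i _ => hd i
  have h2 : (∏ i ∈ Finset.range (n + 1), (e + i)) ≠ 0 := Finset.prod_ne_zero_iff.2 fun i _ => he i
  have h3 : (∏ i ∈ Finset.range n, ((u : ℝ) + 1 + i)) ≠ 0 :=
    Finset.prod_ne_zero_iff.2 fun i _ => hu i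
  have h4 : (u : ℝ) + 1 + n ≠ 0 := hu n
  have h5 : (n : ℝ) + (u + 1) ≠ 0 := by positivity
  have hf : (n.factorial : ℝ) = ∏ i ∈ Finset.range n, ((i : ℝ) + 1) := by
    rw [← Finset.prod_range_add_one_eq_factorial]; push_cast; rfl
  have hf0 : (∏ i ∈ Finset.range n, ((i : ℝ) + 1)) ≠ 0 := by
    rw [← hf]; positivity
  have e1 : (n : ℝ) ^ (d + e - u) = (n : ℝ) ^ d * (n : ℝ) ^ e / (n : ℝ) ^ ((u : ℝ) + 1) * n := by
    rw [Real.rpow_sub hn', Real.rpow_add hn', Real.rpow_add hn', Real.rpow_one]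
    field_simp
  have h6 : (n : ℝ) ^ ((u : ℝ) + 1) ≠ 0 := by positivity
  simp only [Pi.div_apply, Real.GammaSeq, hypTerm, e1, hf]
  rw [Finset.prod_range_succ (fun i : ℕ => (u : ℝ) + 1 + (i : ℝ)) n]
  field_simp
  ring

theorem tendsto_mul_rpow_zero {g : ℕ → ℝ} {L P Q : ℝ} (hQ : Q < P)
    (h : Tendsto (fun n : ℕ => g n * (n : ℝ) ^ P) atTop (𝓝 L)) :
    Tendsto (fun n : ℕ => g n * (n : ℝ) ^ Q) atTop (𝓝 0) := by
  have h1 : Tendsto (fun n : ℕ => (n : ℝ) ^ (-(P - Q))) atTop (𝓝 0) :=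
    (tendsto_rpow_neg_atTop (sub_pos.2 hQ)).comp tendsto_natCast_atTop_atTop
  have := h.mul h1
  rw [mul_zero] at this
  refine this.congr' ?_
  filter_upwards [eventually_gt_atTop 0] with n hn
  have hn' : (0 : ℝ) < n := by exact_mod_cast hn
  rw [mul_assoc, ← Real.rpow_add hn']
  ring_nf

theorem tendsto_hypTerm_mul_linear (u : ℕ) {d e : ℝ} (c : ℝ) (hd : ∀ i : ℕ, d + i ≠ 0)
    (he : ∀ i : ℕ, e + i ≠ 0) (h : u + 1 < d + e) :
    Tendsto (fun n : ℕ => hypTerm u d e n * (n + c)) atTop (𝓝 0) := by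
  obtain ⟨L, -, hL⟩ := tendsto_hypTerm_mul_rpow u hd he
  have h1 := tendsto_mul_rpow_zero (Q := 1) (by linarith) hL
  have h2 := tendsto_mul_rpow_zero (Q := 0) (by linarith) hL
  have := h1.add (h2.mul_const c)
  simp only [Real.rpow_one, Real.rpow_zero, zero_mul, add_zero] at this
  refine this.congr fun n => by ring

theorem cast_hypTerm (u : ℕ) (d e : ℚ) (m : ℕ) :
    ((hypTerm u d e m : ℚ) : ℝ) = hypTerm u (d : ℝ) (e : ℝ) m := by
  simp [hypTerm]

theorem cast_add_ne_zero {d : ℚ} (hd : ∀ i : ℕ, d + i ≠ 0) (i : ℕ) : (d : ℝ) + i ≠ 0 := by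
  exact_mod_cast hd i

theorem tendsto_cast_hypTerm_mul_linear (u : ℕ) {d e : ℚ} (c : ℚ) (hd : ∀ i : ℕ, d + i ≠ 0)
    (he : ∀ i : ℕ, e + i ≠ 0) (h : u + 1 < d + e) :
    Tendsto (fun n : ℕ => ((hypTerm u d e n * (n + c) : ℚ) : ℝ)) atTop (𝓝 0) := by
  have := tendsto_hypTerm_mul_linear u (c : ℝ) (cast_add_ne_zero hd) (cast_add_ne_zero he)
    (by exact_mod_cast h)
  refine this.congr fun n => ?_
  push_cast [cast_hypTerm]
  rfl

/-! ### Series with sum in ℚ + ℚˣπ². -/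

/-- The series of rationals converges to `r + s π ^ 2` with `r` and `s ≠ 0` rational. -/
def HasPiSqSum (h : ℕ → ℚ) : Prop :=
  ∃ r s : ℚ, s ≠ 0 ∧
    Tendsto (fun n => ∑ m ∈ Finset.range n, (h m : ℝ)) atTop (𝓝 (r + s * Real.pi ^ 2))

theorem HasPiSqSum.of_telescoping {h h' G : ℕ → ℚ} {c c' : ℚ} (hc : c ≠ 0) (hc' : c' ≠ 0)
    (hG : Tendsto (fun n => (G n : ℝ)) atTop (𝓝 0))
    (H : ∀ m, c * h m + c' * h' m = G (m + 1) - G m) (hh : HasPiSqSum h) : HasPiSqSum h' := by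
  obtain ⟨r, s, hs, hlim⟩ := hh
  refine ⟨(-G 0 - c * r) / c', - (c * s) / c', div_ne_zero (neg_ne_zero.2 (mul_ne_zero hc hs)) hc',
    ?_⟩
  have hc'' : (c' : ℝ) ≠ 0 := by exact_mod_cast hc'
  have e : ∀ n, ∑ m ∈ Finset.range n, (h' m : ℝ)
      = ((G n : ℝ) - G 0 - c * ∑ m ∈ Finset.range n, (h m : ℝ)) / c' := by
    intro n
    rw [eq_div_iff hc'', Finset.mul_sum, Finset.sum_mul, ← Finset.sum_range_sub (fun m => (G m : ℝ)),
      ← Finset.sum_sub_distrib]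
    refine Finset.sum_congr rfl fun m _ => ?_
    have := H m
    have h2 : (c : ℝ) * h m + c' * h' m = G (m + 1) - G m := by exact_mod_cast this
    linarith
  simp_rw [e]
  have := ((hG.sub_const (G 0 : ℝ)).sub (hlim.const_mul (c : ℝ))).div_const (c' : ℝ)
  convert this using 2
  push_cast
  field_simp
  ring

theorem HasPiSqSum.of_telescoping' {h h' G : ℕ → ℚ} {c c' : ℚ} (hc : c ≠ 0) (hc' : c' ≠ 0)
    (hG : Tendsto (fun n => (G n : ℝ)) atTop (𝓝 0))
    (H : ∀ m, c * h m + c' * h' m = G (m + 1) - G m) (hh : HasPiSqSum h') : HasPiSqSum h :=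
  hh.of_telescoping hc' hc hG fun m => by rw [add_comm]; exact H m

theorem half_integer_add_ne_zero (j l : ℤ) : (j : ℚ) + 1 / 2 + l ≠ 0 := by
  intro h
  have : ((2 * (j + l) + 1 : ℤ) : ℚ) = 0 := by push_cast; linarith
  have := Int.cast_eq_zero.1 this
  omega

theorem half_integer_add_nat_ne_zero (j : ℤ) (i : ℕ) : (j : ℚ) + 1 / 2 + i ≠ 0 :=
  half_integer_add_ne_zero j i

theorem hypTerm_eq_wallisProd (m : ℕ) :
    ((hypTerm 0 1 (1 / 2) m : ℚ) : ℝ) = wallisProd (m + 1) / ((m : ℝ) + 1) ^ 2 := by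
  induction m with
  | zero => norm_num [hypTerm, wallisProd]
  | succ m ih =>
    rw [hypTerm_succ, wallisProd_succ]
    push_cast
    rw [ih]
    have h2 : (1 / 2 : ℝ) + (m + 1) ≠ 0 := by positivity
    have h3 : (1 : ℝ) + (m + 1) ≠ 0 := by positivity
    field_simp
    ring

theorem hasPiSqSum_base : HasPiSqSum (hypTerm 0 1 (1 / 2)) := by
  refine ⟨0, 1 / 2, by norm_num, ?_⟩
  simp_rw [hypTerm_eq_wallisProd]
  convert tendsto_sum_wallisProd using 2
  push_cast
  ring

/-- Induction from the base series, raising u and d = u+1 simultaneously. -/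
theorem hasPiSqSum_half_upper (u : ℕ) : HasPiSqSum (hypTerm u (u + 1) (1 / 2)) := by
  induction u with
  | zero => simpa using hasPiSqSum_base
  | succ u ih =>
    have he : ∀ i : ℕ, (1 / 2 : ℚ) + i ≠ 0 := fun i => by positivity
    have hd : ∀ i : ℕ, (u : ℚ) + 1 + i ≠ 0 := fun i => by positivity
    refine HasPiSqSum.of_telescoping (c := u + 1 - 1 / 2) (c' := -(u + 1))
      (G := fun m => hypTerm u ((u : ℚ) + 1) (1 / 2) m * (m + 1 / 2)) ?_ ?_ ?_ ?_ ih
    · have : (0 : ℚ) ≤ u := u.cast_nonneg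
      linarith
    · exact neg_ne_zero.2 (by positivity)
    · exact tendsto_cast_hypTerm_mul_linear u _ hd he (by linarith)
    · intro m
      have := hypTerm_contiguous_upper u he m
      push_cast at *
      rw [← this, add_assoc (u : ℚ) 1 1]
      norm_num

/-- The convergence condition d+e > u+1 does double duty: the boundary term tends to 0 and the
coefficient 1+u-d-e is nonzero. -/
theorem HasPiSqSum.contiguous_iff {u : ℕ} {d e : ℚ} (hd : ∀ i : ℕ, d + i ≠ 0)
    (he : ∀ i : ℕ, e + i ≠ 0) (h : u + 1 < d + e) (hu : e ≠ u) :
    HasPiSqSum (hypTerm u d e) ↔ HasPiSqSum (hypTerm u d (e + 1)) := by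
  have h1 : (1 + u - d - e) ≠ 0 := by intro h0; linarith
  have hG := tendsto_cast_hypTerm_mul_linear u d hd he h
  exact ⟨.of_telescoping h1 (sub_ne_zero.2 hu) hG (hypTerm_contiguous u hd he),
    .of_telescoping' h1 (sub_ne_zero.2 hu) hG (hypTerm_contiguous u hd he)⟩

theorem hasPiSqSum_half (u v : ℕ) : HasPiSqSum (hypTerm u (u + v + 1) (1 / 2)) := by
  induction v with
  | zero => simpa using hasPiSqSum_half_upper u
  | succ v ih =>
    have he : ∀ i : ℕ, (1 / 2 : ℚ) + i ≠ 0 := fun i => by positivity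
    have hd : ∀ i : ℕ, (u : ℚ) + v + 1 + i ≠ 0 := fun i => by positivity
    have hv : (0 : ℚ) ≤ v := v.cast_nonneg
    have h1 : ∀ d : ℚ, hypTerm u d (1 / 2) = hypTerm u (1 / 2) d := fun d =>
      funext fun m => hypTerm_comm u d _ m
    rw [h1] at ih ⊢
    have := (HasPiSqSum.contiguous_iff (u := u) he hd (by linarith) (by intro h; linarith)).1 ih
    push_cast
    rwa [← add_assoc (u : ℚ)]

/-- The series `∑ m! (u + 1)_m / ((u + v + 1)_{m + 1} (w + 1 / 2)_{m + 1})` lies in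
`ℚ + ℚˣ π ^ 2` whenever it converges. -/
theorem hasPiSqSum_hypTerm (u v : ℕ) (w : ℤ) (h : 0 ≤ (v : ℤ) + w) :
    HasPiSqSum (hypTerm u (u + v + 1) (w + 1 / 2)) := by
  have step : ∀ w : ℤ, 0 ≤ (v : ℤ) + w → (HasPiSqSum (hypTerm u (u + v + 1) (w + 1 / 2)) ↔
      HasPiSqSum (hypTerm u (u + v + 1) ((w + 1 : ℤ) + 1 / 2))) := by
    intro w hw
    have hw' : (0 : ℚ) ≤ v + w := by exact_mod_cast hw
    rw [HasPiSqSum.contiguous_iff (fun i => by positivity) (half_integer_add_nat_ne_zero w)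
      (by linarith) (sub_ne_zero.1 ?_)]
    · push_cast
      rw [add_right_comm (w : ℚ)]
    · simpa [sub_eq_add_neg] using half_integer_add_ne_zero w (-u)
  -- All admissible w are linked to the least one, w = -v, and through it to w = 0, which is already
  -- known.
  have main : ∀ n : ℕ, HasPiSqSum (hypTerm u (u + v + 1) (((n : ℤ) - v : ℤ) + 1 / 2)) ↔
      HasPiSqSum (hypTerm u (u + v + 1) (((0 : ℤ) - v : ℤ) + 1 / 2)) := by
    intro n
    induction n with
    | zero => rfl
    | succ n ih =>
      rw [← ih, step ((n : ℤ) - v) (by omega)]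
      push_cast
      rw [add_sub_right_comm]
  obtain ⟨n, hn⟩ := Int.eq_ofNat_of_zero_le h
  have hw : w = (n : ℤ) - v := by omega
  rw [hw, main n, ← main v]
  simpa using hasPiSqSum_half u v

/-! ### The Hahn difference equation. -/

/-- The difference equation of the Hahn polynomial of degree `k`, at the point `n`. -/
def HahnEq {K : Type*} [Field K] (u : ℕ) (d e : K) (k : ℕ) (f : ℕ → K) (n : ℕ) : Prop :=
  (n + d) * (n + e) * (f (n + 1) - f n) - n * (n + u) * (f n - f (n - 1))
    = k * (k + d + e - u - 1) * f n

section
variable {K : Type*} [Field K]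

theorem HahnEq.smul {u k n : ℕ} {d e : K} {f : ℕ → K} (h : HahnEq u d e k f n) (c : K) :
    HahnEq u d e k (fun m => c * f m) n := by
  unfold HahnEq at *
  linear_combination c * h

theorem HahnEq.sub {u k n : ℕ} {d e : K} {f g : ℕ → K} (hf : HahnEq u d e k f n)
    (hg : HahnEq u d e k g n) : HahnEq u d e k (fun m => f m - g m) n := by
  unfold HahnEq at *
  linear_combination hf - hg

/-- The solution for the parameters `d, e, k + 1` whose differences are the solution `g` for
`d + 1, e + 1, k`. -/
def hahnLift (u : ℕ) (d e : K) (k : ℕ) (g : ℕ → K) (n : ℕ) : K :=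
  ((1 + d) * (1 + e) * g 1 - (1 + u) * g 0) / ((k + 1) * (k + 1 + d + e - u - 1)) - g 0
    + ∑ i ∈ Finset.range n, g i

theorem hahnLift_succ (u : ℕ) (d e : K) (k : ℕ) (g : ℕ → K) (n : ℕ) :
    hahnLift u d e k g (n + 1) = hahnLift u d e k g n + g n := by
  simp only [hahnLift, Finset.sum_range_succ]
  ring

/-- Differencing the degree k+1 equation gives the degree k equation for g. Conversely, summing
recovers the former up to a constant, which the initial value in `hahnLift` fixes at n = 1. -/
theorem hahnLift_eq {u k : ℕ} {d e : K} (hl : ((k : K) + 1) * (k + 1 + d + e - u - 1) ≠ 0)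
    {g : ℕ → K} (hg : ∀ n, HahnEq u (d + 1) (e + 1) k g (n + 1)) (n : ℕ) :
    HahnEq u d e (k + 1) (hahnLift u d e k g) (n + 1) := by
  have key : ∀ n : ℕ, ((n : K) + 1 + d) * (n + 1 + e) * g (n + 1) - (n + 1) * (n + 1 + u) * g n
      = (k + 1) * (k + 1 + d + e - u - 1) * hahnLift u d e k g (n + 1) := by
    intro n
    induction n with
    | zero =>
      simp only [hahnLift, Finset.sum_range_one, zero_add]
      rw [sub_add_cancel, mul_div_cancel₀ _ hl]
      push_cast
      ring
    | succ n ih =>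
      have h := hg n
      rw [hahnLift_succ]
      unfold HahnEq at h
      simp only [Nat.add_sub_cancel] at h
      push_cast at *
      linear_combination ih + h
  unfold HahnEq
  rw [hahnLift_succ u d e k g (n + 1), Nat.add_sub_cancel]
  have := key n
  rw [hahnLift_succ u d e k g n] at *
  push_cast
  linear_combination this

/-- At n = 0 the coefficient n(n+u) vanishes, so the equation is a genuine initial condition. It is
tracked separately because y satisfies it, whereas for x only the equations at n ≥ 1 are asserted.
-/
theorem hahnLift_eq_zero {u k : ℕ} {d e : K} (hl : ((k : K) + 1) * (k + 1 + d + e - u - 1) ≠ 0)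
    {g : ℕ → K} (hg : HahnEq u (d + 1) (e + 1) k g 0) :
    d * e * g 0 = (k + 1) * (k + 1 + d + e - u - 1) * hahnLift u d e k g 0 := by
  unfold HahnEq at hg
  simp only [hahnLift, Finset.sum_range_zero, add_zero]
  push_cast at hg
  rw [mul_sub, mul_div_cancel₀ _ hl]
  linear_combination -hg

end

theorem tendsto_succ_pow_sub_pow (k : ℕ) :
    Tendsto (fun n : ℕ => (((n : ℝ) + 1) ^ (k + 1) - (n : ℝ) ^ (k + 1)) / (n : ℝ) ^ k) atTop
      (𝓝 (k + 1)) := by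
  induction k with
  | zero => simp
  | succ k ih =>
    have h1 : Tendsto (fun n : ℕ => ((n : ℝ) + 1) / n) atTop (𝓝 1) := by
      have := (tendsto_one_div_atTop_nhds_zero_nat (𝕜 := ℝ)).const_add 1
      rw [add_zero] at this
      refine this.congr' ?_
      filter_upwards [eventually_gt_atTop 0] with n hn
      field_simp
    have := (h1.mul ih).add_const 1
    push_cast
    rw [one_mul] at this
    refine this.congr' ?_
    filter_upwards [eventually_gt_atTop 0] with n hn
    field_simp
    ring

/-- If `g n ∼ a n ^ k` then the sums of `g` are `∼ a / (k + 1) n ^ (k + 1)`; `a = 0` is allowed. -/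
theorem tendsto_sum_div_pow {g : ℕ → ℝ} {k : ℕ} {a : ℝ} (c : ℝ)
    (hg : Tendsto (fun n : ℕ => g n / (n : ℝ) ^ k) atTop (𝓝 a)) :
    Tendsto (fun n : ℕ => (c + ∑ i ∈ Finset.range n, g i) / (n : ℝ) ^ (k + 1)) atTop
      (𝓝 (a / (k + 1))) := by
  have hk : (k : ℝ) + 1 ≠ 0 := by positivity
  set D : ℕ → ℝ := fun n => ((n : ℝ) + 1) ^ (k + 1) - (n : ℝ) ^ (k + 1) with hD
  have hsum : ∀ n, ∑ i ∈ Finset.range n, D i = (n : ℝ) ^ (k + 1) := by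
    intro n
    have := Finset.sum_range_sub (fun m : ℕ => (m : ℝ) ^ (k + 1)) n
    simpa [hD] using this
  have hle : ∀ n : ℕ, (n : ℝ) ^ k ≤ D n := by
    intro n
    have h1 : (n : ℝ) ^ k ≤ ((n : ℝ) + 1) ^ k := by gcongr; linarith
    have h2 : (0 : ℝ) ≤ n := n.cast_nonneg
    simp only [hD, pow_succ]
    nlinarith
  have htop : Tendsto (fun n : ℕ => (n : ℝ) ^ (k + 1)) atTop atTop :=
    (tendsto_pow_atTop (Nat.succ_ne_zero k)).comp tendsto_natCast_atTop_atTop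
  -- Stolz–Cesàro: compare g with the differences D of n^(k+1), whose sums are known exactly.
  have h1 : (fun n => g n - a / (k + 1) * D n) =o[atTop] fun n : ℕ => (n : ℝ) ^ k := by
    refine (Asymptotics.isLittleO_iff_tendsto' ?_).2 ?_
    · filter_upwards [eventually_gt_atTop 0] with n hn h0
      exact absurd h0 (by positivity)
    · have := hg.sub ((tendsto_succ_pow_sub_pow k).const_mul (a / (k + 1)))
      rw [div_mul_cancel₀ _ hk, sub_self] at this
      exact this.congr fun n => by simp only [hD]; ring
  have h2 : (fun n => g n - a / (k + 1) * D n) =o[atTop] D := by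
    refine h1.trans_isBigO (Asymptotics.IsBigO.of_bound 1 (Eventually.of_forall fun n => ?_))
    rw [one_mul, Real.norm_of_nonneg (by positivity), Real.norm_of_nonneg]
    · exact hle n
    · exact (pow_nonneg n.cast_nonneg k).trans (hle n)
  have h3 := h2.sum_range (fun n => (pow_nonneg n.cast_nonneg k).trans (hle n))
    (by simp_rw [hsum]; exact htop)
  simp_rw [hsum] at h3
  have h4 := (h3.tendsto_div_nhds_zero.add (tendsto_const_nhds (x := c) |>.div_atTop htop)).add_const
    (a / (k + 1))
  rw [add_zero, zero_add] at h4
  refine h4.congr' ?_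
  filter_upwards [eventually_gt_atTop 0] with n hn
  rw [Finset.sum_sub_distrib, ← Finset.mul_sum, hsum]
  have : (n : ℝ) ^ (k + 1) ≠ 0 := by positivity
  field_simp
  ring

/-- Induction on k through `hahnLift`. The constant S survives each lift because summation preserves
o(n^k) after dividing by the next power. -/
theorem exists_hahn_solutions (u k : ℕ) (d e : ℚ) {S : ℝ} (hd : ∀ i : ℕ, d + i ≠ 0)
    (he : ∀ i : ℕ, e + i ≠ 0) (hde : ∀ i : ℕ, d + e - u - 1 + i ≠ 0)
    (hS : Tendsto (fun n => ∑ m ∈ Finset.range n, ((hypTerm u (d + k) (e + k) m : ℚ) : ℝ)) atTop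
      (𝓝 S)) :
    ∃ x y : ℕ → ℚ, (∀ n, HahnEq u d e k y n) ∧ (∀ n, HahnEq u d e k x (n + 1)) ∧ y 0 ≠ 0 ∧
      (∀ c : ℚ, x ≠ fun n => c * y n) ∧
      (∃ c : ℝ, c ≠ 0 ∧ Tendsto (fun n : ℕ => (y n : ℝ) / (n : ℝ) ^ k) atTop (𝓝 c)) ∧
      Tendsto (fun n : ℕ => ((x n : ℝ) - S * y n) / (n : ℝ) ^ k) atTop (𝓝 0) := by
  induction k generalizing d e with
  | zero =>
    refine ⟨fun n => ∑ m ∈ Finset.range n, hypTerm u d e m, fun _ => 1, ?_, ?_, one_ne_zero, ?_,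
      ⟨1, one_ne_zero, by simp⟩, ?_⟩
    · intro n
      simp [HahnEq]
    · intro n
      have h1 := hd (n + 1)
      have h2 := he (n + 1)
      simp only [HahnEq, Nat.add_sub_cancel, Finset.sum_range_succ, hypTerm_succ]
      push_cast at *
      field_simp
      ring
    · intro c hc
      have h0 := congrFun hc 0
      have h1 := congrFun hc 1
      simp only [Finset.range_zero, Finset.sum_empty, mul_one] at h0
      rw [← h0] at h1
      simp only [Finset.sum_range_one, mul_one] at h1
      exact hypTerm_ne_zero hd he 0 h1
    · have := hS.sub_const S
      simpa using this
  | succ k ih =>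
    have hs : ∀ a : ℚ, a + 1 + k = a + (k + 1 : ℕ) := fun a => by push_cast; ring
    obtain ⟨x, y, hy, hx, hy0, hxy, ⟨c, hc, hyc⟩, hlim⟩ := ih (d + 1) (e + 1)
      (fun i => by have := hd (i + 1); push_cast at this; rwa [add_assoc, add_comm (1 : ℚ)])
      (fun i => by have := he (i + 1); push_cast at this; rwa [add_assoc, add_comm (1 : ℚ)])
      (fun i => by
        have := hde (i + 2)
        push_cast at this
        intro h
        exact this (by linear_combination h))
      (by simpa only [hs] using hS)
    have hl : ((k : ℚ) + 1) * (k + 1 + d + e - u - 1) ≠ 0 := by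
      refine mul_ne_zero (by positivity) fun h => hde (k + 1) ?_
      push_cast
      linear_combination h
    have hstep : ∀ n, HahnEq u d e (k + 1) (hahnLift u d e k y) (n + 1) :=
      hahnLift_eq hl fun n => hy _
    have hzero := hahnLift_eq_zero hl (hy 0)
    refine ⟨hahnLift u d e k x, hahnLift u d e k y, ?_, hahnLift_eq hl hx, ?_, ?_, ?_, ?_⟩
    · intro n
      cases n with
      | zero =>
        unfold HahnEq
        rw [hahnLift_succ]
        push_cast
        linear_combination hzero
      | succ n => exact hstep n
    · intro h
      rw [h, mul_zero] at hzero
      have hd0 := hd 0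
      have he0 := he 0
      simp only [Nat.cast_zero, add_zero] at hd0 he0
      exact mul_ne_zero (mul_ne_zero hd0 he0) hy0 hzero
    · intro c hc
      refine hxy c (funext fun n => ?_)
      have h1 := congrFun hc n
      have h2 := congrFun hc (n + 1)
      simp only [hahnLift_succ] at h1 h2
      linear_combination h2 - h1
    · refine ⟨c / (k + 1), div_ne_zero hc (by positivity), ?_⟩
      have := tendsto_sum_div_pow
        ((hahnLift u d e k y 0 : ℚ) : ℝ) hyc
      refine this.congr fun n => ?_
      simp [hahnLift]
    · have := tendsto_sum_div_pow
        (((hahnLift u d e k x 0 : ℚ) : ℝ) - S * ((hahnLift u d e k y 0 : ℚ) : ℝ)) hlim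
      rw [zero_div] at this
      refine this.congr fun n => ?_
      simp only [hahnLift, Finset.range_zero, Finset.sum_empty, add_zero, Finset.sum_sub_distrib,
        ← Finset.mul_sum]
      push_cast
      ring

/-! ### Numerators and denominators of continued fractions. -/

section contFrac
variable (a b : ℕ → ℚ)

theorem contFrac_get? (n : ℕ) : (contFrac a b).s.get? n = some ⟨b n, a (n + 1)⟩ := rfl

theorem contFrac_nums_zero : (contFrac a b).nums 0 = a 0 := rfl

theorem contFrac_dens_zero : (contFrac a b).dens 0 = 1 := rfl

theorem contFrac_nums_one : (contFrac a b).nums 1 = a 1 * a 0 + b 0 :=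
  GenContFract.first_num_eq (contFrac_get? a b 0)

theorem contFrac_dens_one : (contFrac a b).dens 1 = a 1 :=
  GenContFract.first_den_eq (contFrac_get? a b 0)

theorem contFrac_nums_add_two (n : ℕ) : (contFrac a b).nums (n + 2)
    = a (n + 2) * (contFrac a b).nums (n + 1) + b (n + 1) * (contFrac a b).nums n :=
  GenContFract.nums_recurrence (contFrac_get? a b (n + 1)) rfl rfl

theorem contFrac_dens_add_two (n : ℕ) : (contFrac a b).dens (n + 2)
    = a (n + 2) * (contFrac a b).dens (n + 1) + b (n + 1) * (contFrac a b).dens n :=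
  GenContFract.dens_recurrence (contFrac_get? a b (n + 1)) rfl rfl

variable {a b}

/-- Each step multiplies the determinant by -b(n+1). -/
theorem contFrac_det_ne_zero (hb : ∀ n, b n ≠ 0) (n : ℕ) :
    (contFrac a b).nums n * (contFrac a b).dens (n + 1)
      - (contFrac a b).nums (n + 1) * (contFrac a b).dens n ≠ 0 := by
  induction n with
  | zero =>
    rw [contFrac_nums_zero, contFrac_dens_zero, contFrac_nums_one, contFrac_dens_one]
    intro h
    exact hb 0 (by linear_combination -h)
  | succ n ih =>
    rw [contFrac_nums_add_two, contFrac_dens_add_two]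
    intro h
    exact mul_ne_zero (hb (n + 1)) ih (by linear_combination -h)

/-- Two sequences with the three-term recurrence of a continued fraction and the right initial
values are its numerators and denominators. -/
theorem contFrac_nums_dens_eq {P Q : ℕ → ℚ} (hP0 : P 0 = a 0) (hP1 : P 1 = a 1 * a 0 + b 0)
    (hQ0 : Q 0 = 1) (hQ1 : Q 1 = a 1)
    (hP : ∀ n, P (n + 2) = a (n + 2) * P (n + 1) + b (n + 1) * P n)
    (hQ : ∀ n, Q (n + 2) = a (n + 2) * Q (n + 1) + b (n + 1) * Q n) (n : ℕ) :
    (contFrac a b).nums n = P n ∧ (contFrac a b).dens n = Q n := by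
  induction n using Nat.twoStepInduction with
  | zero => exact ⟨hP0.symm, hQ0.symm⟩
  | one => exact ⟨(contFrac_nums_one a b).trans hP1.symm, (contFrac_dens_one a b).trans hQ1.symm⟩
  | more n h1 h2 =>
    rw [contFrac_nums_add_two, contFrac_dens_add_two, hP, hQ, h1.1, h1.2, h2.1, h2.2]
    exact ⟨rfl, rfl⟩

end contFrac

/-! ### Asymptotics of a null sequence from its differences. -/

theorem tendsto_rpow_neg_sub (P : ℝ) :
    Tendsto (fun n : ℕ => ((n : ℝ) ^ (-P) - ((n + 1 : ℕ) : ℝ) ^ (-P)) * (n : ℝ) ^ (P + 1)) atTop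
      (𝓝 P) := by
  have hder : HasDerivAt (fun x : ℝ => (1 + x) ^ (-P)) (-P) 0 := by
    have := ((hasDerivAt_id (0 : ℝ)).const_add 1).rpow_const (p := -P) (Or.inl (by simp))
    simpa using this
  have hinv : Tendsto (fun n : ℕ => 1 / (n : ℝ)) atTop (𝓝[≠] 0) := by
    refine tendsto_nhdsWithin_iff.2 ⟨tendsto_one_div_atTop_nhds_zero_nat, ?_⟩
    filter_upwards [eventually_gt_atTop 0] with n hn
    have : (n : ℝ) ≠ 0 := by positivity
    simpa using this
  have := ((hasDerivAt_iff_tendsto_slope_zero.1 hder).comp hinv).neg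
  rw [neg_neg] at this
  refine this.congr' ?_
  filter_upwards [eventually_gt_atTop 0] with n hn
  have hn' : (0 : ℝ) < n := by exact_mod_cast hn
  have e1 : ((n + 1 : ℕ) : ℝ) ^ (-P) = (n : ℝ) ^ (-P) * (1 + 1 / (n : ℝ)) ^ (-P) := by
    rw [← Real.mul_rpow hn'.le (by positivity)]
    congr 1
    push_cast
    field_simp
  have e2 : (n : ℝ) ^ (-P) * (n : ℝ) ^ (P + 1) = n := by
    rw [← Real.rpow_add hn', neg_add_cancel_left, Real.rpow_one]
  simp only [Function.comp, smul_eq_mul, zero_add, add_zero, Real.one_rpow, e1]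
  rw [one_div, inv_inv]
  linear_combination ((1 + (n : ℝ)⁻¹) ^ (-P) - 1) * e2

theorem tendsto_mul_rpow_zero_of_sub {x : ℕ → ℝ} {P : ℝ} (hP : 0 < P)
    (hx : Tendsto x atTop (𝓝 0))
    (h : Tendsto (fun n : ℕ => (x (n + 1) - x n) * (n : ℝ) ^ (P + 1)) atTop (𝓝 0)) :
    Tendsto (fun n : ℕ => x n * (n : ℝ) ^ P) atTop (𝓝 0) := by
  have hs : Tendsto (fun n : ℕ => (n : ℝ) ^ (-P)) atTop (𝓝 0) :=
    (tendsto_rpow_neg_atTop hP).comp tendsto_natCast_atTop_atTop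
  rw [Metric.tendsto_atTop]
  intro ε hε
  have h1 := (((tendsto_rpow_neg_sub P).const_mul (ε / 2)).sub h).eventually_const_lt
    (u := 0) (by rw [sub_zero]; positivity)
  have h2 := (((tendsto_rpow_neg_sub P).const_mul (ε / 2)).add h).eventually_const_lt
    (u := 0) (by positivity)
  obtain ⟨N, hN⟩ := eventually_atTop.1 (h1.and (h2.and (eventually_gt_atTop 0)))
  have hdiff : ∀ n ≥ N, x (n + 1) - x n ≤ ε / 2 * ((n : ℝ) ^ (-P) - ((n + 1 : ℕ) : ℝ) ^ (-P)) ∧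
      -(x (n + 1) - x n) ≤ ε / 2 * ((n : ℝ) ^ (-P) - ((n + 1 : ℕ) : ℝ) ^ (-P)) := by
    intro n hn
    obtain ⟨a1, a2, a3⟩ := hN n hn
    have hpos : (0 : ℝ) < (n : ℝ) ^ (P + 1) := by positivity
    constructor
    · refine le_of_mul_le_mul_right ?_ hpos
      linarith
    · refine le_of_mul_le_mul_right ?_ hpos
      linarith
  have hbound : ∀ n ≥ N, |x n| ≤ ε / 2 * (n : ℝ) ^ (-P) := by
    intro n hn
    -- Both (ε/2) n^(-P) ± x(n) are eventually decreasing with limit 0, hence nonnegative.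
    have t1 := ((hs.const_mul (ε / 2)).sub hx).comp (tendsto_add_atTop_nat N)
    have t2 := ((hs.const_mul (ε / 2)).add hx).comp (tendsto_add_atTop_nat N)
    rw [mul_zero, sub_zero] at t1
    rw [mul_zero, add_zero] at t2
    have m1 := Antitone.le_of_tendsto (antitone_nat_of_succ_le fun m => ?_) t1 (n - N)
    have m2 := Antitone.le_of_tendsto (antitone_nat_of_succ_le fun m => ?_) t2 (n - N)
    · simp only [Function.comp, Nat.sub_add_cancel hn] at m1 m2
      exact abs_le.2 ⟨by linarith, by linarith⟩
    · have := (hdiff (m + N) (by omega)).1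
      have := (hdiff (m + N) (by omega)).2
      simp only [Function.comp, add_right_comm m 1 N]
      linarith
    · have := (hdiff (m + N) (by omega)).1
      have := (hdiff (m + N) (by omega)).2
      simp only [Function.comp, add_right_comm m 1 N]
      linarith
  refine ⟨N, fun n hn => ?_⟩
  have hn' : (0 : ℝ) < n := by exact_mod_cast (hN n hn).2.2
  have e1 : (n : ℝ) ^ (-P) * (n : ℝ) ^ P = 1 := by
    rw [← Real.rpow_add hn', neg_add_cancel, Real.rpow_zero]
  have hp : (0 : ℝ) < (n : ℝ) ^ P := by positivity
  rw [Real.dist_eq, sub_zero, abs_mul, abs_of_pos hp]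
  calc |x n| * (n : ℝ) ^ P ≤ ε / 2 * (n : ℝ) ^ (-P) * (n : ℝ) ^ P :=
        mul_le_mul_of_nonneg_right (hbound n hn) hp.le
    _ = ε / 2 := by rw [mul_assoc, e1, mul_one]
    _ < ε := half_lt_self hε

/-- If `r n → 0` and `r (n + 1) - r n ∼ c / n ^ (P + 1)`, then `r n ∼ - (c / P) / n ^ P`. -/
theorem tendsto_mul_rpow_of_sub {r : ℕ → ℝ} {P c : ℝ} (hP : 0 < P)
    (hr : Tendsto r atTop (𝓝 0))
    (h : Tendsto (fun n : ℕ => (r (n + 1) - r n) * (n : ℝ) ^ (P + 1)) atTop (𝓝 c)) :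
    Tendsto (fun n : ℕ => r n * (n : ℝ) ^ P) atTop (𝓝 (-(c / P))) := by
  have hs : Tendsto (fun n : ℕ => (n : ℝ) ^ (-P)) atTop (𝓝 0) :=
    (tendsto_rpow_neg_atTop hP).comp tendsto_natCast_atTop_atTop
  have hsd := tendsto_rpow_neg_sub P
  have hx : Tendsto (fun n => r n + c / P * (n : ℝ) ^ (-P)) atTop (𝓝 0) := by
    simpa using hr.add (hs.const_mul (c / P))
  have hxd : Tendsto (fun n : ℕ => ((r (n + 1) + c / P * ((n + 1 : ℕ) : ℝ) ^ (-P))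
      - (r n + c / P * (n : ℝ) ^ (-P))) * (n : ℝ) ^ (P + 1)) atTop (𝓝 0) := by
    have := h.sub (hsd.const_mul (c / P))
    rw [div_mul_cancel₀ _ hP.ne', sub_self] at this
    exact this.congr fun n => by ring
  have hx0 := tendsto_mul_rpow_zero_of_sub hP hx hxd
  have := hx0.sub_const (c / P)
  rw [zero_sub] at this
  refine this.congr' ?_
  filter_upwards [eventually_gt_atTop 0] with n hn
  have hn' : (0 : ℝ) < n := by exact_mod_cast hn
  have : (n : ℝ) ^ (-P) * (n : ℝ) ^ P = 1 := by
    rw [← Real.rpow_add hn', neg_add_cancel, Real.rpow_zero]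
  linear_combination c / P * this

theorem exists_primitive {X : ℕ → ℝ} {P c : ℝ} (hP : 0 < P)
    (h : Tendsto (fun n : ℕ => X n * (n : ℝ) ^ (P + 1)) atTop (𝓝 c)) :
    ∃ r : ℕ → ℝ, (∀ n, r (n + 1) - r n = X n) ∧ Tendsto r atTop (𝓝 0) := by
  have hO : X =O[atTop] fun n : ℕ => (n : ℝ) ^ (-(P + 1)) := by
    refine (Asymptotics.isBigO_of_div_tendsto_nhds ?_ c (h.congr' ?_))
    · filter_upwards [eventually_gt_atTop 0] with n hn h0
      exact absurd h0 (by positivity)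
    · filter_upwards [eventually_gt_atTop 0] with n hn
      simp only [Pi.div_apply]
      rw [Real.rpow_neg (by positivity), div_inv_eq_mul]
  have hsum : Summable X :=
    summable_of_isBigO_nat (Real.summable_nat_rpow.2 (by linarith)) hO
  refine ⟨fun n => ∑ m ∈ Finset.range n, X m - ∑' m, X m, fun n => ?_, ?_⟩
  · simp only [Finset.sum_range_succ]
    ring
  · have := hsum.hasSum.tendsto_sum_nat.sub_const (∑' m, X m)
    rwa [sub_self] at this

/-! ### The Casoratian and the speed of convergence. -/

theorem hahn_casoratian {u k : ℕ} {d e : ℝ} (hd : ∀ i : ℕ, d + i ≠ 0) (he : ∀ i : ℕ, e + i ≠ 0)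
    {f y : ℕ → ℝ} {N : ℕ} (hf : ∀ n ≥ N, HahnEq u d e k f (n + 1))
    (hy : ∀ n ≥ N, HahnEq u d e k y (n + 1)) :
    ∃ κ : ℝ, ∀ n ≥ N, y n * f (n + 1) - y (n + 1) * f n = κ * hypTerm u d e n := by
  refine ⟨(y N * f (N + 1) - y (N + 1) * f N) / hypTerm u d e N, fun n hn => ?_⟩
  induction n, hn using Nat.le_induction with
  | base => rw [div_mul_cancel₀ _ (hypTerm_ne_zero hd he N)]
  | succ n hn ih =>
    have h1 := hf n hn
    have h2 := hy n hn
    have h3 : d + ((n : ℝ) + 1) ≠ 0 := by exact_mod_cast hd (n + 1)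
    have h4 : e + ((n : ℝ) + 1) ≠ 0 := by exact_mod_cast he (n + 1)
    unfold HahnEq at h1 h2
    rw [hypTerm_succ, ← mul_assoc, ← ih, mul_div_assoc', eq_div_iff (mul_ne_zero h3 h4)]
    simp only [Nat.add_sub_cancel] at h1 h2
    push_cast at *
    linear_combination y (n + 1) * h1 - f (n + 1) * h2

/-- Every solution is a combination of a dominant solution `y` and of `y * ρ` with `ρ → 0`. -/
theorem hahn_representation {u k : ℕ} {d e : ℝ} (hd : ∀ i : ℕ, d + i ≠ 0) (he : ∀ i : ℕ, e + i ≠ 0)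
    (hP : 0 < d + e - u - 1 + 2 * k) {y : ℕ → ℝ} (hy : ∀ n, HahnEq u d e k y (n + 1)) {c : ℝ}
    (hc : c ≠ 0) (hyc : Tendsto (fun n : ℕ => y n / (n : ℝ) ^ k) atTop (𝓝 c)) :
    (∀ᶠ n in atTop, y n ≠ 0) ∧ ∃ ρ : ℕ → ℝ, Tendsto ρ atTop (𝓝 0) ∧
      (∃ C : ℝ, C ≠ 0 ∧
        Tendsto (fun n : ℕ => ρ n * (n : ℝ) ^ (d + e - u - 1 + 2 * k)) atTop (𝓝 C)) ∧
      ∀ f : ℕ → ℝ, (∀ᶠ n in atTop, HahnEq u d e k f (n + 1)) →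
        ∃ L κ : ℝ, ∀ᶠ n in atTop, f n = y n * (L + κ * ρ n) := by
  have hy0 : ∀ᶠ n in atTop, y n ≠ 0 := by
    filter_upwards [hyc.eventually_ne hc] with n hn h0
    simp [h0] at hn
  obtain ⟨C, hC, hCt⟩ := tendsto_hypTerm_mul_rpow u hd he
  -- By the Casoratian formula, f/y has differences κ X(n), so ρ is taken to be the null sequence
  -- with differences X.
  set X : ℕ → ℝ := fun n => hypTerm u d e n / (y n * y (n + 1)) with hX
  have hyc' : Tendsto (fun n : ℕ => y (n + 1) / (n : ℝ) ^ k) atTop (𝓝 c) := by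
    have h1 : Tendsto (fun n : ℕ => (((n + 1 : ℕ) : ℝ) / n) ^ k) atTop (𝓝 1) := by
      have := ((tendsto_one_div_atTop_nhds_zero_nat (𝕜 := ℝ)).const_add 1).pow k
      rw [add_zero, one_pow] at this
      refine this.congr' ?_
      filter_upwards [eventually_gt_atTop 0] with n hn
      push_cast
      field_simp
    have h2 := (hyc.comp (tendsto_add_atTop_nat 1)).mul h1
    rw [mul_one] at h2
    refine h2.congr' ?_
    filter_upwards [eventually_gt_atTop 0] with n hn
    simp only [Function.comp]
    rw [div_pow]
    field_simp
  have hXt : Tendsto (fun n : ℕ => X n * (n : ℝ) ^ (d + e - u - 1 + 2 * k + 1)) atTop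
      (𝓝 (C / (c * c))) := by
    refine (hCt.div (hyc.mul hyc') (mul_ne_zero hc hc)).congr' ?_
    filter_upwards [eventually_gt_atTop 0, hy0, (tendsto_add_atTop_nat 1).eventually hy0]
      with n hn h1 h2
    have hn' : (0 : ℝ) < n := by exact_mod_cast hn
    have e1 : (n : ℝ) ^ (d + e - u - 1 + 2 * k + 1) = (n : ℝ) ^ (d + e - u) * ((n : ℝ) ^ k) ^ 2 := by
      rw [← pow_mul, ← Real.rpow_natCast, ← Real.rpow_add hn']
      congr 1
      push_cast
      ring
    simp only [Pi.div_apply, hX, e1]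
    field_simp
  obtain ⟨ρ, hρ, hρ0⟩ := exists_primitive hP hXt
  refine ⟨hy0, ρ, hρ0, ⟨_, ?_, tendsto_mul_rpow_of_sub hP hρ0 (c := C / (c * c)) ?_⟩, ?_⟩
  · exact neg_ne_zero.2 (div_ne_zero (div_ne_zero hC (mul_ne_zero hc hc)) hP.ne')
  · simpa only [hρ] using hXt
  · intro f hf
    obtain ⟨N, hN⟩ := eventually_atTop.1 (hf.and hy0)
    obtain ⟨κ, hκ⟩ := hahn_casoratian hd he (fun n hn => (hN n hn).1) (fun n _ => hy n)
    refine ⟨f N / y N - κ * ρ N, κ, eventually_atTop.2 ⟨N, fun n hn => ?_⟩⟩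
    refine ((div_eq_iff (hN n hn).2).1 ?_).trans (mul_comm _ _)
    induction n, hn using Nat.le_induction with
    | base => ring
    | succ n hn ih =>
      have h1 := (hN n hn).2
      have h2 := (hN (n + 1) (by omega)).2
      have h3 := hκ n hn
      have h4 := hρ n
      simp only [hX] at h4
      have h5 : f (n + 1) / y (n + 1) - f n / y n = κ * (ρ (n + 1) - ρ n) := by
        rw [h4, mul_div_assoc', ← h3]
        field_simp
      linear_combination h5 + ih

/-- The speed of convergence of a quotient of two solutions. -/
theorem quotient_speed {y ρ fp fq : ℕ → ℝ} {Lp κp Lq κq z P C : ℝ} (hy : ∀ᶠ n in atTop, y n ≠ 0)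
    (hρ : Tendsto ρ atTop (𝓝 0)) (hC : C ≠ 0)
    (hρC : Tendsto (fun n : ℕ => ρ n * (n : ℝ) ^ P) atTop (𝓝 C))
    (hp : ∀ᶠ n in atTop, fp n = y n * (Lp + κp * ρ n))
    (hq : ∀ᶠ n in atTop, fq n = y n * (Lq + κq * ρ n))
    (hq0 : ∀ᶠ n in atTop, fq n ≠ 0)
    (hW : ∀ n, fp n * fq (n + 1) - fp (n + 1) * fq n ≠ 0)
    (hz : Tendsto (fun n => fp n / fq n) atTop (𝓝 z)) :
    ∃ C' : ℝ, C' ≠ 0 ∧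
      Tendsto (fun n : ℕ => (z - fp n / fq n) * (n : ℝ) ^ P) atTop (𝓝 C') := by
  -- The Casoratian of fp and fq has this determinant as a factor.
  have hdet : Lp * κq - Lq * κp ≠ 0 := by
    intro h
    obtain ⟨n, h1, h2, h3, h4⟩ := (hp.and (hq.and (((tendsto_add_atTop_nat 1).eventually hp).and
      ((tendsto_add_atTop_nat 1).eventually hq)))).exists
    refine hW n ?_
    rw [h1, h2, h3, h4]
    linear_combination y n * y (n + 1) * (ρ (n + 1) - ρ n) * h
  have hpt : Tendsto (fun n => Lp + κp * ρ n) atTop (𝓝 Lp) := by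
    simpa using (hρ.const_mul κp).const_add Lp
  have hqt : Tendsto (fun n => Lq + κq * ρ n) atTop (𝓝 Lq) := by
    simpa using (hρ.const_mul κq).const_add Lq
  have hquot : ∀ᶠ n in atTop, fp n / fq n = (Lp + κp * ρ n) / (Lq + κq * ρ n) := by
    filter_upwards [hp, hq, hy] with n h1 h2 h3
    rw [h1, h2, mul_div_mul_left _ _ h3]
  have hne : ∀ᶠ n in atTop, Lq + κq * ρ n ≠ 0 := by
    filter_upwards [hq, hq0] with n h1 h2 h3
    rw [h1, h3, mul_zero] at h2
    exact h2 rfl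
  have hmul : Lp = z * Lq := by
    refine tendsto_nhds_unique hpt ((hz.mul hqt).congr' ?_)
    filter_upwards [hquot, hne] with n h1 h2
    rw [h1, div_mul_cancel₀ _ h2]
  have hLq : Lq ≠ 0 := by
    intro h
    simp [hmul, h] at hdet
  have hnum : z * κq - κp ≠ 0 := by
    intro h
    refine hdet ?_
    rw [hmul]
    linear_combination Lq * h
  refine ⟨(z * κq - κp) * C / Lq, div_ne_zero (mul_ne_zero hnum hC) hLq, ?_⟩
  refine ((hρC.const_mul (z * κq - κp)).div hqt hLq).congr' ?_
  filter_upwards [hquot, hne] with n h1 h2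
  rw [h1]
  simp only [Pi.div_apply]
  rw [hmul]
  field_simp
  ring

theorem HahnEq.cast {u k n : ℕ} {d e : ℚ} {f : ℕ → ℚ} (h : HahnEq u d e k f n) :
    HahnEq u (d : ℝ) (e : ℝ) k (fun m => (f m : ℝ)) n := by
  unfold HahnEq at *
  have := congrArg (fun x : ℚ => (x : ℝ)) h
  push_cast at this ⊢
  exact this

theorem HahnEq.eq_zero {K : Type*} [Field K] {u k : ℕ} {d e : K} (hd : ∀ i : ℕ, d + i ≠ 0)
    (he : ∀ i : ℕ, e + i ≠ 0) {f : ℕ → K} (h : ∀ n, HahnEq u d e k f (n + 1)) (h0 : f 0 = 0)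
    (h1 : f 1 = 0) (n : ℕ) : f n = 0 := by
  induction n using Nat.twoStepInduction with
  | zero => exact h0
  | one => exact h1
  | more n h2 h3 =>
    have := h n
    unfold HahnEq at this
    rw [Nat.add_sub_cancel, h2, h3] at this
    simp only [sub_zero, mul_zero] at this
    rw [add_comm _ d, add_comm _ e] at this
    exact (mul_eq_zero.1 this).resolve_left (mul_ne_zero (hd _) (he _))

/-! ### From the Hahn equation to the half-integer family. -/

/-- The factor relating solutions of the Hahn equation to numerators and denominators. -/
def halfNorm (d e : ℚ) (n : ℕ) : ℚ := ∏ i ∈ Finset.range n, (2 * (d + i) * (e + i))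

theorem halfNorm_zero (d e : ℚ) : halfNorm d e 0 = 1 := rfl

theorem halfNorm_succ (d e : ℚ) (n : ℕ) :
    halfNorm d e (n + 1) = halfNorm d e n * (2 * (d + n) * (e + n)) := Finset.prod_range_succ _ _

theorem halfNorm_ne_zero {d e : ℚ} (hd : ∀ i : ℕ, d + i ≠ 0) (he : ∀ i : ℕ, e + i ≠ 0) (n : ℕ) :
    halfNorm d e n ≠ 0 :=
  Finset.prod_ne_zero_iff.2 fun i _ => mul_ne_zero (mul_ne_zero two_ne_zero (hd i)) (he i)

section
variable (u v k : ℕ) (w : ℤ)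

theorem halfFamilyA_eval (x : ℚ) : (halfFamilyA u v w k).eval x
    = 4 * x ^ 2 + (6 * (u : ℚ) + 2 * v + 2 * w - 5) * x
      + (2 * (k : ℚ) ^ 2 + (2 * u + 2 * v + 2 * w + 1) * k + 2 * u ^ 2 + (2 * v + 2 * w - 3) * u
        + v * (2 * w - 1) + 2) := by
  simp only [halfFamilyA, eval_add, eval_mul, eval_pow, eval_X, eval_C, eval_ofNat]

theorem halfFamilyB_eval (x : ℚ) : (halfFamilyB u v w).eval x
    = -2 * x * (x + u) * (x + (u + v)) * (2 * x + (2 * u + 2 * w - 1)) := by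
  simp only [halfFamilyB, eval_add, eval_mul, eval_neg, eval_X, eval_C, eval_ofNat]

theorem halfFamilyB_eval_ne_zero (n : ℕ) : (halfFamilyB u v w).eval ((n : ℚ) + 1) ≠ 0 := by
  rw [halfFamilyB_eval]
  have h1 : (n : ℚ) + 1 ≠ 0 := by positivity
  have h2 : (n : ℚ) + 1 + u ≠ 0 := by positivity
  have h3 : (n : ℚ) + 1 + (u + v) ≠ 0 := by positivity
  have h4 : 2 * ((n : ℚ) + 1) + (2 * u + 2 * w - 1) ≠ 0 := by
    have := half_integer_add_ne_zero (n + u + w) 0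
    intro h
    push_cast at this
    exact this (by linear_combination h / 2)
  exact mul_ne_zero (mul_ne_zero (mul_ne_zero (mul_ne_zero (by norm_num) h1) h2) h3) h4

theorem halfFamily_recurrence_iff (f : ℕ → ℚ) (n : ℕ) :
    HahnEq u ((u : ℚ) + v + 1) (((u + w : ℤ) : ℚ) + 1 / 2) k f (n + 1) ↔
      halfNorm (u + v + 1) ((u + w : ℤ) + 1 / 2) (n + 2) * f (n + 2)
        = (halfFamilyA u v w k).eval ((n + 2 : ℕ) : ℚ)
            * (halfNorm (u + v + 1) ((u + w : ℤ) + 1 / 2) (n + 1) * f (n + 1))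
          + (halfFamilyB u v w).eval ((n + 1 : ℕ) : ℚ)
            * (halfNorm (u + v + 1) ((u + w : ℤ) + 1 / 2) n * f n) := by
  have hd : ∀ i : ℕ, (u : ℚ) + v + 1 + i ≠ 0 := fun i => by positivity
  have he := half_integer_add_nat_ne_zero (u + w)
  have hN := halfNorm_ne_zero hd he (n + 1)
  rw [halfNorm_succ _ _ (n + 1), halfFamilyA_eval, halfFamilyB_eval]
  have hB : -2 * ((n + 1 : ℕ) : ℚ) * ((n + 1 : ℕ) + u) * ((n + 1 : ℕ) + (u + v))
      * (2 * (n + 1 : ℕ) + (2 * u + 2 * w - 1)) * (halfNorm (u + v + 1) ((u + w : ℤ) + 1 / 2) n * f n)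
      = halfNorm (u + v + 1) ((u + w : ℤ) + 1 / 2) (n + 1)
        * (-2 * (n + 1) * (n + 1 + u) * f n) := by
    rw [halfNorm_succ]
    push_cast
    ring
  rw [hB]
  unfold HahnEq
  rw [Nat.add_sub_cancel]
  push_cast at *
  constructor
  · intro h
    linear_combination 2 * halfNorm (u + v + 1) ((u + w) + 1 / 2) (n + 1) * h
  · intro h
    refine mul_left_cancel₀ (mul_ne_zero two_ne_zero hN) ?_
    linear_combination h

end

/-- Rational solutions `x` and `y` with `x / y → r + s π ^ 2`. -/
theorem exists_half_solutions (u v k : ℕ) (w : ℤ) (hP : 0 ≤ (u : ℤ) + v + w + 2 * k) :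
    ∃ (x y : ℕ → ℚ) (r s : ℚ), s ≠ 0 ∧
      (∀ n, HahnEq u ((u : ℚ) + v + 1) (((u + w : ℤ) : ℚ) + 1 / 2) k y n) ∧
      (∀ n, HahnEq u ((u : ℚ) + v + 1) (((u + w : ℤ) : ℚ) + 1 / 2) k x (n + 1)) ∧ y 0 ≠ 0 ∧
      (∀ c : ℚ, x ≠ fun n => c * y n) ∧
      (∃ c : ℝ, c ≠ 0 ∧ Tendsto (fun n : ℕ => (y n : ℝ) / (n : ℝ) ^ k) atTop (𝓝 c)) ∧
      Tendsto (fun n : ℕ => ((x n : ℝ) - (r + s * Real.pi ^ 2) * y n) / (n : ℝ) ^ k) atTop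
        (𝓝 0) := by
  -- The k lifts shift both lower parameters by k, so the convergence condition becomes exactly
  -- u+v+w+2k ≥ 0.
  obtain ⟨r, s, hs, hS⟩ := hasPiSqSum_hypTerm u (v + k) (u + w + k) (by push_cast; linarith)
  obtain ⟨x, y, h⟩ := exists_hahn_solutions u k ((u : ℚ) + v + 1) (((u + w : ℤ) : ℚ) + 1 / 2)
    (S := r + s * Real.pi ^ 2) (fun i => by positivity) (half_integer_add_nat_ne_zero (u + w))
    (fun i => by
      have := half_integer_add_ne_zero (u + v + w) i
      intro h
      push_cast at this h
      exact this (by linear_combination h))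
    (by
      have e1 : (u : ℚ) + v + 1 + k = u + (v + k : ℕ) + 1 := by push_cast; ring
      have e2 : ((u + w : ℤ) : ℚ) + 1 / 2 + k = (u + w + k : ℤ) + 1 / 2 := by push_cast; ring
      rw [e1, e2]
      exact hS)
  exact ⟨x, y, r, s, hs, h⟩

theorem halfFamily_represents (u v k : ℕ) (w : ℤ) (hP : 0 ≤ (u : ℤ) + v + w + 2 * k) :
    Represents (halfFamilyA u v w k) (halfFamilyB u v w) (Real.pi ^ 2) := by
  obtain ⟨x, y, r, s, hs, hy, hx, hy0, hxy, ⟨c, hc, hyc⟩, hlim⟩ := exists_half_solutions u v k w hP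
  have hd : ∀ i : ℕ, (u : ℚ) + v + 1 + i ≠ 0 := fun i => by positivity
  have he := half_integer_add_nat_ne_zero (u + w)
  set d : ℚ := (u : ℚ) + v + 1 with hd_def
  set e : ℚ := ((u + w : ℤ) : ℚ) + 1 / 2 with he_def
  set A := halfFamilyA u v w k with hA
  set B := halfFamilyB u v w with hB
  -- As x/y → r + sπ², these combinations have p/q → π²; the factor 1/y(0) normalises q(0) = 1.
  set p : ℕ → ℚ := fun n => (s * y 0)⁻¹ * (x n - r * y n) with hp_def
  set q : ℕ → ℚ := fun n => (y 0)⁻¹ * y n with hq_def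
  have hp : ∀ n, HahnEq u d e k p (n + 1) := fun n => ((hx n).sub ((hy _).smul r)).smul _
  have hq : ∀ n, HahnEq u d e k q (n + 1) := fun n => (hy _).smul _
  set P : ℕ → ℚ := fun n => halfNorm d e n * p n with hP_def
  set Q : ℕ → ℚ := fun n => halfNorm d e n * q n with hQ_def
  have hQ0 : Q 0 = 1 := by simp [hQ_def, hq_def, halfNorm_zero, hy0]
  -- This is the Hahn equation of y at n = 0, so a(1) needs no modification.
  have hQ1 : Q 1 = A.eval 1 := by
    have h := hy 0
    unfold HahnEq at h
    simp only [hQ_def, hq_def, halfNorm_succ, halfNorm_zero, hA, halfFamilyA_eval]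
    simp only [hd_def, he_def] at h ⊢
    field_simp
    push_cast at h ⊢
    linear_combination 2 * h
  have hdet : P 1 - A.eval 1 * P 0 ≠ 0 := by
    intro h
    rw [← hQ1] at h
    have h2 : halfNorm d e 1 * (s * y 0 * y 0)⁻¹ * (x 1 * y 0 - x 0 * y 1) = 0 := by
      rw [← h]
      simp only [hP_def, hQ_def, hp_def, hq_def, halfNorm_zero]
      field_simp
      ring
    have h3 : x 1 * y 0 - x 0 * y 1 = 0 :=
      (mul_eq_zero.1 h2).resolve_left (mul_ne_zero (halfNorm_ne_zero hd he 1)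
        (inv_ne_zero (mul_ne_zero (mul_ne_zero hs hy0) hy0)))
    refine hxy (x 0 / y 0) (funext fun n => sub_eq_zero.1 ?_)
    refine HahnEq.eq_zero hd he (f := fun n => x n - x 0 / y 0 * y n)
      (fun n => (hx n).sub ((hy (n + 1)).smul (x 0 / y 0))) ?_ ?_ n
    · field_simp
      ring
    · field_simp
      linear_combination h3
  -- Only the index 0 departs from A and B: a(0) and b(0) are forced by P(0) and P(1), and b(0) ≠ 0
  -- by independence of x and y.
  set a : ℕ → ℚ := fun n => if n = 0 then P 0 else A.eval (n : ℚ) with ha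
  set b : ℕ → ℚ := fun n => if n = 0 then P 1 - A.eval 1 * P 0 else B.eval (n : ℚ) with hb
  have hrec := contFrac_nums_dens_eq (a := a) (b := b) (P := P) (Q := Q) (by simp [ha])
    (by simp [ha, hb]) hQ0 (by simp [ha, hQ1])
    (fun n => by
      rw [ha, hb]
      simp only [Nat.add_eq_zero_iff, OfNat.ofNat_ne_zero, one_ne_zero, and_false, if_false]
      exact (halfFamily_recurrence_iff u v k w p n).1 (hp n))
    (fun n => by
      rw [ha, hb]
      simp only [Nat.add_eq_zero_iff, OfNat.ofNat_ne_zero, one_ne_zero, and_false, if_false]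
      exact (halfFamily_recurrence_iff u v k w q n).1 (hq n))
  have hyev : ∀ᶠ n in atTop, y n ≠ 0 := by
    filter_upwards [hyc.eventually_ne hc] with n hn h0
    simp [h0] at hn
  refine ⟨a, b, fun n => ?_, ?_, ?_, ?_, ?_⟩
  · cases n with
    | zero => simpa [hb] using hdet
    | succ n => simpa [hb] using halfFamilyB_eval_ne_zero u v w n
  · filter_upwards [eventually_gt_atTop 0] with n hn
    simp [ha, hn.ne']
  · filter_upwards [eventually_gt_atTop 0] with n hn
    simp [hb, hn.ne']
  · filter_upwards [hyev] with n hn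
    rw [(hrec n).2]
    exact mul_ne_zero (halfNorm_ne_zero hd he n) (mul_ne_zero (inv_ne_zero hy0) hn)
  · have hs' : (s : ℝ) ≠ 0 := by exact_mod_cast hs
    have h1 := (((hlim.div hyc hc).add_const (r + s * Real.pi ^ 2 : ℝ)).sub_const (r : ℝ)).div_const
      (s : ℝ)
    rw [zero_div, zero_add, add_sub_cancel_left, mul_div_cancel_left₀ _ hs'] at h1
    refine h1.congr' ?_
    filter_upwards [hyev, eventually_gt_atTop 0] with n hn hn0
    have hn' : (y n : ℝ) ≠ 0 := by exact_mod_cast hn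
    have hy0' : (y 0 : ℝ) ≠ 0 := by exact_mod_cast hy0
    have hN : (halfNorm d e n : ℝ) ≠ 0 := by exact_mod_cast halfNorm_ne_zero hd he n
    rw [GenContFract.conv_eq_num_div_den, (hrec n).1, (hrec n).2]
    simp only [hP_def, hQ_def, hp_def, hq_def, Pi.div_apply]
    push_cast
    field_simp
    ring

/-- After division by N, numerators and denominators eventually solve the Hahn equation whatever the
initial coefficients, so the rate does not depend on the limit z. -/
theorem halfFamily_speed (u v k : ℕ) (w : ℤ) (hP : 0 ≤ (u : ℤ) + v + w + 2 * k) {a b : ℕ → ℚ}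
    {z : ℝ} (h : IsCFOfType (halfFamilyA u v w k) (halfFamilyB u v w) z a b) :
    HasCFSpeed a b z ((u : ℝ) + v + w + 2 * k + 1 / 2) := by
  obtain ⟨-, y, -, -, -, hy, -, -, -, ⟨c, hc, hyc⟩, -⟩ := exists_half_solutions u v k w hP
  have hd : ∀ i : ℕ, (u : ℚ) + v + 1 + i ≠ 0 := fun i => by positivity
  have he := half_integer_add_nat_ne_zero (u + w)
  have hN := halfNorm_ne_zero hd he
  set N := halfNorm ((u : ℚ) + v + 1) (((u + w : ℤ) : ℚ) + 1 / 2) with hN_def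
  have hexp : (((u : ℚ) + v + 1 : ℚ) : ℝ) + ((((u + w : ℤ) : ℚ) + 1 / 2 : ℚ) : ℝ) - u - 1 + 2 * k
      = (u : ℝ) + v + w + 2 * k + 1 / 2 := by
    push_cast
    ring
  have hP' : (0 : ℝ) ≤ (u : ℝ) + v + w + 2 * k := by exact_mod_cast hP
  obtain ⟨hy0, ρ, hρ, ⟨C, hC, hρC⟩, hrep⟩ := hahn_representation (cast_add_ne_zero hd)
    (cast_add_ne_zero he) (by rw [hexp]; linarith) (fun n => (hy (n + 1)).cast) hc hyc
  rw [hexp] at hρC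
  have hsol : ∀ g : ℕ → ℚ, (∀ n, g (n + 2) = a (n + 2) * g (n + 1) + b (n + 1) * g n) →
      ∃ L κ : ℝ, ∀ᶠ n in atTop, ((g n / N n : ℚ) : ℝ) = y n * (L + κ * ρ n) := by
    intro g hg
    refine hrep _ ?_
    filter_upwards [(tendsto_add_atTop_nat 2).eventually h.a_eq,
      (tendsto_add_atTop_nat 1).eventually h.b_eq] with n h1 h2
    refine HahnEq.cast (f := fun n => g n / N n) ((halfFamily_recurrence_iff u v k w _ n).2 ?_)
    simp only [← hN_def]
    rw [mul_div_cancel₀ _ (hN _), mul_div_cancel₀ _ (hN _), mul_div_cancel₀ _ (hN _), ← h1, ← h2]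
    exact hg n
  obtain ⟨Lp, κp, hp⟩ := hsol _ (contFrac_nums_add_two a b)
  obtain ⟨Lq, κq, hq⟩ := hsol _ (contFrac_dens_add_two a b)
  have hconv : ∀ n, (((contFrac a b).convs n : ℚ) : ℝ)
      = (((contFrac a b).nums n / N n : ℚ) : ℝ) / (((contFrac a b).dens n / N n : ℚ) : ℝ) := by
    intro n
    rw [GenContFract.conv_eq_num_div_den, ← Rat.cast_div, div_div_div_cancel_right₀ (hN n)]
  have := quotient_speed (z := z) hy0 hρ hC hρC hp hq ?_ ?_ ?_
  · unfold HasCFSpeed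
    simpa only [hconv] using this
  · filter_upwards [h.converges.1] with n hn
    exact_mod_cast div_ne_zero hn (hN n)
  · intro n hn
    refine contFrac_det_ne_zero (a := a) h.b_ne_zero n ?_
    have h1 := hN n
    have h2 := hN (n + 1)
    have h3 : (contFrac a b).nums n / N n * ((contFrac a b).dens (n + 1) / N (n + 1))
        - (contFrac a b).nums (n + 1) / N (n + 1) * ((contFrac a b).dens n / N n) = 0 := by
      exact_mod_cast hn
    field_simp at h3
    linear_combination h3
  · simpa only [hconv] using h.converges.2

theorem mainTheorem4 (u v k : ℕ) (w : ℤ) (hP : 0 ≤ (u : ℤ) + v + w + 2 * k) :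
    Represents (halfFamilyA u v w k) (halfFamilyB u v w) (Real.pi ^ 2) ∧
    (∀ a b : ℕ → ℚ, IsCFOfType (halfFamilyA u v w k) (halfFamilyB u v w) (Real.pi ^ 2) a b →
      HasCFSpeed a b (Real.pi ^ 2) ((u : ℝ) + v + w + 2 * k + 1 / 2)) ∧
    halfFamilyA u v w k = 2 * firstFamilyA u v ((w : ℚ) - 1 / 2) k ∧
    halfFamilyB u v w = 4 * firstFamilyB u v ((w : ℚ) - 1 / 2) := by
  refine ⟨halfFamily_represents u v k w hP, fun a b h => halfFamily_speed u v k w hP h, ?_, ?_⟩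
  · refine Polynomial.funext fun x => ?_
    rw [halfFamilyA_eval]
    simp only [firstFamilyA, eval_add, eval_mul, eval_pow, eval_X, eval_C, eval_ofNat]
    ring
  · refine Polynomial.funext fun x => ?_
    rw [halfFamilyB_eval]
    simp only [firstFamilyB, eval_add, eval_mul, eval_neg, eval_X, eval_C, eval_ofNat]
    ring
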